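/- Setting. Let $\Sigma = CS \uplus FS$ be a signature of constructor symbols $CS=\bigcup_n CS^n$ and function symbols $FS=\bigcup_n FS^n$ (disjoint, each symbol with an arity $n$), with a distinguished function symbol $? \in FS^2$ written infix, and let $\mathcal V$ be a countably infinite set of variables. Expressions are given by $e ::= X \mid h(e_1,\dots,e_n)$ with $X\in\mathcal V$ and $h\in CS^n\cup FS^n$; c-terms are the expressions without function symbols; an expression is ground if no variable occurs in it. A substitution $\sigma$ maps variables to expressions and has finite domain $\mathrm{dom}(\sigma)=\{X\mid X\sigma\neq X\}$. A program (left-linear constructor system) $P$ over $\Sigma$ is a set of rules $f(p_1,\dots,p_n)\to r$, where $f\in FS^n$, $r$ is an expression, and $(p_1,\dots,p_n)$ is a tuple of c-terms in which each variable occurs at most once; $r$ may contain extra variables, that is, variables not occurring in $f(p_1,\dots,p_n)$. It is assumed that the rules of $P$ for the symbol $?$ are exactly $X\,?\,Y\to X$ and $X\,?\,Y\to Y$ (with $X\ne Y$). We write $P\vdash e\to^* e'$ for the reflexive-transitive closure of term rewriting, $C[l\sigma]\to C[r\sigma]$ for one-hole contexts $C$, rules $(l\to r)\in P$ and substitutions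 $\sigma$. Let $gen$ be a fresh function symbol of arity $0$. The program $gt(P)$ over $\Sigma\cup\{gen\}$ consists of the rules $gen\to c(gen,\dots,gen)$, one for each constructor symbol $c\in CS$, and of the rules $f(p_1,\dots,p_n)\to r[\overline{X}/gen]$, one for each rule $f(p_1,\dots,p_n)\to r$ of $P$, where $\overline X$ is the set of extra variables of that rule; here $[\overline X/gen]$ is the substitution that maps every variable of the finite set $\overline X$ to $gen$ and fixes all other variables. Let $\bot$ be a new constructor symbol of arity $0$. The shell of an expression is defined by $|X|=X$, $|c(e_1,\dots,e_n)|=c(|e_1|,\dots,|e_n|)$ for $c \in CS$, and $|f(e_1,\dots,e_n)|=\bot$ for function symbols $f$ (including $gen$). On expressions that may contain $\bot$, $\sqsubseteq$ is the least partial order such that $\bot\sqsubseteq e$ for all $e$, and $e\sqsubseteq e'$ implies $C[e]\sqsubseteq C[e']$ for all one-hole contexts $C$. Theorem (Lifting). Let $P$ be a program over $\Sigma$ and let $e$ be an expression over $\Sigma$. Soundness. Let $\overline X$ be a finite set of variables and $e'$ a ground expression over $\Sigma\cup\{gen\}$. If $gt(P)\vdash e[\overline X/gen]\to^* e'$, then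 there is a substitution $\sigma$ over $\Sigma$ with $\mathrm{dom}(\sigma)=\overline X$ such that $P\vdash e\sigma\to^* e''$ for some expression $e''$ over $\Sigma$ with $|e'|\sqsubseteq|e''|$; moreover, if $e'$ is a c-term $t$, then $P\vdash e\sigma\to^* t$ for this $\sigma$. Completeness. Let $\sigma$ be any substitution over $\Sigma$ (not necessarily normalized), and let $e'$ be a ground expression over $\Sigma$. If $P\vdash e\sigma\to^* e'$, then $gt(P)\vdash e[\overline X/gen]\to^* e''$ for $\overline X=\mathrm{dom}(\sigma)$ and some expression $e''$ over $\Sigma\cup\{gen\}$ with $|e'|\sqsubseteq|e''|$; moreover, if $e'$ is a c-term $t$, then $gt(P)\vdash e[\overline X/gen]\to^* t$. -/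

import Mathlib

universe u v w

namespace GenLift

noncomputable section

open scoped Classical

/-- A signature `Σ = CS ⊎ FS`: constructor symbols and defined function symbols, each family
indexed by arity, with a distinguished binary function symbol `?`. -/
structure Signature where
  Con : ℕ → Type u
  Fn : ℕ → Type v
  choice : Fn 2

/-- The constructor symbols of `Σ` together with the new constant constructor `⊥`. -/
inductive BotCon (Con : ℕ → Type u) : ℕ → Type u
  | bot : BotCon Con 0
  | old {n : ℕ} (c : Con n) : BotCon Con n

/-- The function symbols of `Σ` together with the fresh constant function symbol `gen`. -/
inductive GenFn (Fn : ℕ → Type v) : ℕ → Type v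
  | gen : GenFn Fn 0
  | old {n : ℕ} (f : Fn n) : GenFn Fn n

/-- The signature `Σ_⊥ = Σ ∪ {⊥}`. -/
abbrev Signature.withBot (S : Signature.{u, v}) : Signature.{u, v} where
  Con := BotCon S.Con
  Fn := S.Fn
  choice := S.choice

/-- The signature `Σ ∪ {gen}`. -/
abbrev Signature.withGen (S : Signature.{u, v}) : Signature.{u, v} where
  Con := S.Con
  Fn := GenFn S.Fn
  choice := GenFn.old S.choice

/-- Expressions `e ::= X | h(e₁, …, eₙ)` with `h` a constructor or a function symbol. -/
inductive Exp (S : Signature.{u, v}) (V : Type w) : Type (max u v w)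
  | var (x : V) : Exp S V
  | con {n : ℕ} (c : S.Con n) (args : Fin n → Exp S V) : Exp S V
  | fn {n : ℕ} (f : S.Fn n) (args : Fin n → Exp S V) : Exp S V

/-- Partial expressions are the expressions over `Σ_⊥`. -/
abbrev PExp (S : Signature.{u, v}) (V : Type w) := Exp S.withBot V

namespace Exp

variable {S : Signature.{u, v}} {V : Type w}

/-- The set of variables occurring in an expression. -/
def vars : Exp S V → Finset V
  | var x => {x}
  | con _ args => Finset.univ.biUnion fun i => (args i).vars
  | fn _ args => Finset.univ.biUnion fun i => (args i).vars

/-- The number of occurrences of the variable `x` in an expression. -/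
def occ (x : V) : Exp S V → ℕ
  | var y => if y = x then 1 else 0
  | con _ args => ∑ i, (args i).occ x
  | fn _ args => ∑ i, (args i).occ x

/-- An expression is ground if no variable occurs in it. -/
def IsGround (e : Exp S V) : Prop := e.vars = ∅

/-- The c-terms: expressions without function symbols. -/
def IsCTerm : Exp S V → Prop
  | var _ => True
  | con _ args => ∀ i, (args i).IsCTerm
  | fn _ _ => False

/-- The inclusion of the expressions over `Σ` in those over `Σ ∪ {gen}`. -/
def lift : Exp S V → Exp S.withGen V
  | var x => var x
  | con c args => con (S := S.withGen) c fun i => (args i).lift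
  | fn f args => fn (S := S.withGen) (GenFn.old f) fun i => (args i).lift

/-- The expression `gen`. -/
def gen : Exp S.withGen V := fn (S := S.withGen) GenFn.gen Fin.elim0

/-- The partial expression `⊥`. -/
def bot : PExp S V := con (S := S.withBot) BotCon.bot Fin.elim0

/-- The shell `|e|`. -/
def shell : Exp S V → PExp S V
  | var x => var x
  | con c args => con (S := S.withBot) (BotCon.old c) fun i => (args i).shell
  | fn _ _ => bot

end Exp

/-- One-hole contexts `C ::= [ ] | h(e₁, …, C, …, eₙ)`. In `con c i args C` and `fn f i args C` the
context `C` stands at argument position `i`, and the value of `args` at `i` is ignored. -/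
inductive Context (S : Signature.{u, v}) (V : Type w) : Type (max u v w)
  | hole : Context S V
  | con {n : ℕ} (c : S.Con n) (i : Fin n) (args : Fin n → Exp S V) (C : Context S V) : Context S V
  | fn {n : ℕ} (f : S.Fn n) (i : Fin n) (args : Fin n → Exp S V) (C : Context S V) : Context S V

/-- `C.plug e` is `C[e]`. -/
def Context.plug {S : Signature.{u, v}} {V : Type w} : Context S V → Exp S V → Exp S V
  | .hole, e => e
  | .con c i args C, e => .con c (Function.update args i (C.plug e))
  | .fn f i args C, e => .fn f (Function.update args i (C.plug e))

/-- The approximation ordering on partial expressions: the least preorder with `⊥ ⊑ e` that is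
closed under contexts. It is antisymmetric (`Approx.antisymm`), hence it is the least partial
ordering with these properties. -/
inductive Approx {S : Signature.{u, v}} {V : Type w} : PExp S V → PExp S V → Prop
  | refl (e : PExp S V) : Approx e e
  | trans {e₁ e₂ e₃ : PExp S V} : Approx e₁ e₂ → Approx e₂ e₃ → Approx e₁ e₃
  | bot_le (e : PExp S V) : Approx Exp.bot e
  | ctx (C : Context S.withBot V) {e e' : PExp S V} : Approx e e' → Approx (C.plug e) (C.plug e')

/-- Substitutions: mappings from variables to expressions that move only finitely many variables. -/
structure Subst (S : Signature.{u, v}) (V : Type w) where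
  toFun : V → Exp S V
  finite_dom : {x | toFun x ≠ Exp.var x}.Finite

/-- `dom(σ) = {X | Xσ ≠ X}`. -/
def Subst.dom {S : Signature.{u, v}} {V : Type w} (σ : Subst S V) : Finset V :=
  σ.finite_dom.toFinset

/-- `e.subst σ` is `eσ`. -/
def Exp.subst {S : Signature.{u, v}} {V : Type w} (σ : Subst S V) : Exp S V → Exp S V
  | .var x => σ.toFun x
  | .con c args => .con c fun i => (args i).subst σ
  | .fn f args => .fn f fun i => (args i).subst σ

/-- The substitution `[X̄/gen]`. -/
def genSubst {S : Signature.{u, v}} {V : Type w} (X : Finset V) : Subst S.withGen V where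
  toFun x := if x ∈ X then Exp.gen else Exp.var x
  finite_dom := X.finite_toSet.subset fun x hx => by
    by_contra h
    exact hx (if_neg h)

/-- A rewrite rule `f(p₁, …, pₙ) → r`. -/
structure Rule (S : Signature.{u, v}) (V : Type w) where
  arity : ℕ
  head : S.Fn arity
  pats : Fin arity → Exp S V
  rhs : Exp S V

namespace Rule

variable {S : Signature.{u, v}} {V : Type w}

/-- The left-hand side `f(p₁, …, pₙ)`. -/
def lhs (R : Rule S V) : Exp S V := .fn R.head R.pats

/-- The extra variables of a rule: those of the right-hand side that are not in the left-hand
side. -/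
def extraVars (R : Rule S V) : Finset V := R.rhs.vars \ R.lhs.vars

/-- `(p₁, …, pₙ)` is a tuple of c-terms in which every variable occurs at most once. -/
def IsCRule (R : Rule S V) : Prop :=
  (∀ i, (R.pats i).IsCTerm) ∧ ∀ x, ∑ i, (R.pats i).occ x ≤ 1

/-- The transformed rule `f(p₁, …, pₙ) → r[X̄/gen]`, with `X̄` the extra variables. -/
def gt (R : Rule S V) : Rule S.withGen V where
  arity := R.arity
  head := GenFn.old R.head
  pats i := (R.pats i).lift
  rhs := R.rhs.lift.subst (genSubst R.extraVars)

end Rule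

/-- The rule `gen → c(gen, …, gen)`. -/
def genRule {S : Signature.{u, v}} (V : Type w) {n : ℕ} (c : S.Con n) : Rule S.withGen V where
  arity := 0
  head := GenFn.gen
  pats := Fin.elim0
  rhs := .con (S := S.withGen) c fun _ => Exp.gen

/-- A set of rules is a left-linear constructor system (a program) if its rules are c-rewrite rules
and its rules for `?` are exactly `X ? Y → X` and `X ? Y → Y`, for two different variables. -/
def IsProgram {S : Signature.{u, v}} {V : Type w} (P : Set (Rule S V)) : Prop :=
  (∀ R ∈ P, R.IsCRule) ∧
  ∃ x y : V, x ≠ y ∧ ∀ (p : Fin 2 → Exp S V) (r : Exp S V),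
    (⟨2, S.choice, p, r⟩ : Rule S V) ∈ P ↔
      p = ![Exp.var x, Exp.var y] ∧ (r = Exp.var x ∨ r = Exp.var y)

/-- The transformation `gt(P)`: the rules for `gen` and the transformed rules of `P`. -/
def gt {S : Signature.{u, v}} {V : Type w} (P : Set (Rule S V)) : Set (Rule S.withGen V) :=
  {R | ∃ (n : ℕ) (c : S.Con n), R = genRule V c} ∪ Rule.gt '' P

/-- One rewriting step `C[lσ] → C[rσ]` with a rule `l → r` of `P`. -/
inductive Step {S : Signature.{u, v}} {V : Type w} (P : Set (Rule S V)) : Exp S V → Exp S V → Prop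
  | mk (C : Context S V) (R : Rule S V) (hR : R ∈ P) (σ : Subst S V) :
      Step P (C.plug (R.lhs.subst σ)) (C.plug (R.rhs.subst σ))

/-- `P ⊢ e →* e'`. -/
def Rewrites {S : Signature.{u, v}} {V : Type w} (P : Set (Rule S V)) : Exp S V → Exp S V → Prop :=
  Relation.ReflTransGen (Step P)

/-- The number of symbols different from `⊥`. -/
def psize {S : Signature.{u, v}} {V : Type w} : PExp S V → ℕ
  | .var _ => 1
  | .con BotCon.bot _ => 0
  | .con (BotCon.old _) args => 1 + ∑ i, psize (args i)
  | .fn _ args => 1 + ∑ i, psize (args i)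

theorem sum_psize_update_lt {S : Signature.{u, v}} {V : Type w} {n : ℕ} (args : Fin n → PExp S V)
    (i : Fin n) {a b : PExp S V} (h : psize a < psize b) :
    ∑ j, psize (Function.update args i a j) < ∑ j, psize (Function.update args i b j) := by
  refine Finset.sum_lt_sum (fun j _ => ?_) ⟨i, Finset.mem_univ i, by simpa using h⟩
  by_cases hj : j = i
  · subst hj; simpa using h.le
  · simp [Function.update_of_ne hj]

theorem psize_plug_lt {S : Signature.{u, v}} {V : Type w} (C : Context S.withBot V)
    {a b : PExp S V} (h : psize a < psize b) : psize (C.plug a) < psize (C.plug b) := by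
  induction C with
  | hole => exact h
  | con c i args C ih =>
    cases c with
    | bot => exact i.elim0
    | old c => simpa only [Context.plug, psize, add_lt_add_iff_left] using
        sum_psize_update_lt args i ih
  | fn f i args C ih =>
    simpa only [Context.plug, psize, add_lt_add_iff_left] using sum_psize_update_lt args i ih

theorem Approx.eq_or_psize_lt {S : Signature.{u, v}} {V : Type w} {a b : PExp S V}
    (h : Approx a b) : a = b ∨ psize a < psize b := by
  induction h with
  | refl e => exact Or.inl rfl
  | trans _ _ ih₁ ih₂ =>
    rcases ih₁ with rfl | h₁
    · exact ih₂
    · rcases ih₂ with rfl | h₂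
      · exact Or.inr h₁
      · exact Or.inr (h₁.trans h₂)
  | bot_le e =>
    cases e with
    | var x => exact Or.inr (by simp [psize, Exp.bot])
    | con c args =>
      cases c with
      | bot => exact Or.inl (congrArg _ (Subsingleton.elim _ _))
      | old c => exact Or.inr (by simp [psize, Exp.bot])
    | fn f args => exact Or.inr (by simp [psize, Exp.bot])
  | ctx C _ ih =>
    rcases ih with rfl | h
    · exact Or.inl rfl
    · exact Or.inr (psize_plug_lt C h)

theorem Approx.antisymm {S : Signature.{u, v}} {V : Type w} {a b : PExp S V}
    (h₁ : Approx a b) (h₂ : Approx b a) : a = b := by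
  rcases h₁.eq_or_psize_lt with h | h
  · exact h
  · rcases h₂.eq_or_psize_lt with h' | h'
    · exact h'.symm
    · exact absurd h h'.asymm

end

end GenLift

/-!
Soundness: a derivation in `gt P` is simulated in `P` by replacing every `gen` by one expression
`g`, chosen backwards along the derivation. A step with a transformed rule is an instance of the
original rule that maps the extra variables to `g`. For a step `gen → c(gen, …, gen)`, the
expression `c(g, …, g) ? g` can be used before the step: it rewrites to `c(g, …, g)` at the redex
and to `g` everywhere else.

Completeness: let `b` arise from `a` by replacing some subexpressions by `gen`. Derivations from
`a` in `P` can be followed from `b` in `gt P`: whenever a pattern needs a constructor that `b` does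
not show yet, a rule `gen → c(gen, …, gen)` produces it. By left-linearity, the choices made
for different arguments concern different variables. The same rules finally produce the
constructors of the shell of the ground result.
-/

namespace GenLift

variable {S : Signature.{u, v}} {V : Type w} {P : Set (Rule S V)}

section Congruence

theorem rel_of_forall_rel_of_update {ι α β : Type*} [Finite ι] [DecidableEq ι] {r : α → α → Prop}
    {s : β → β → Prop} [IsPreorder β s] {F : (ι → α) → β}
    (hF : ∀ a i x y, r x y → s (F (Function.update a i x)) (F (Function.update a i y)))
    {a b : ι → α} (h : ∀ i, r (a i) (b i)) : s (F a) (F b) := by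
  cases nonempty_fintype ι
  suffices hT : ∀ T : Finset ι, s (F a) (F (T.piecewise b a)) by simpa using hT Finset.univ
  intro T
  induction T using Finset.induction_on with
  | empty => simpa using refl_of s (F a)
  | insert i T hi ih =>
    have hstep := hF (T.piecewise b a) i (a i) (b i) (h i)
    rw [← Finset.piecewise_insert, ← Finset.piecewise_eq_of_notMem T b a hi,
      Function.update_eq_self] at hstep
    exact trans_of s ih hstep

theorem forall_rel_update {ι α : Type*} [DecidableEq ι] {r : α → α → Prop} (hr : ∀ x, r x x)
    (a : ι → α) (i : ι) {x y : α} (h : r x y) (j : ι) :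
    r (Function.update a i x j) (Function.update a i y j) := by
  obtain rfl | hj := eq_or_ne j i
  · simpa using h
  · simpa [Function.update_of_ne hj] using hr _

theorem Context.rel_plug {r : Exp S V → Exp S V → Prop} (hrefl : ∀ e, r e e)
    (hcon : ∀ {n} (c : S.Con n) {a b : Fin n → Exp S V},
      (∀ i, r (a i) (b i)) → r (.con c a) (.con c b))
    (hfn : ∀ {n} (f : S.Fn n) {a b : Fin n → Exp S V},
      (∀ i, r (a i) (b i)) → r (.fn f a) (.fn f b))
    (C : Context S V) {e e' : Exp S V} (h : r e e') : r (C.plug e) (C.plug e') := by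
  induction C with
  | hole => exact h
  | con c i args _ ih => exact hcon c (forall_rel_update hrefl args i ih)
  | fn f i args _ ih => exact hfn f (forall_rel_update hrefl args i ih)

instance : IsPreorder (PExp S V) Approx where
  refl := .refl
  trans _ _ _ := .trans

theorem Approx.con {n : ℕ} (c : S.withBot.Con n) {a b : Fin n → PExp S V}
    (h : ∀ i, Approx (a i) (b i)) : Approx (Exp.con (S := S.withBot) c a) (.con c b) :=
  rel_of_forall_rel_of_update (fun args i _ _ => Approx.ctx (.con c i args .hole)) h

/-- The composition of contexts, with `D` put into the hole of `C`. -/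
def Context.comp (C D : Context S V) : Context S V :=
  match C with
  | .hole => D
  | .con c i args C => .con c i args (C.comp D)
  | .fn f i args C => .fn f i args (C.comp D)

theorem Context.plug_comp (C D : Context S V) (e : Exp S V) :
    (C.comp D).plug e = C.plug (D.plug e) := by
  induction C with
  | hole => rfl
  | con c i args C ih => simp only [comp, plug, ih]
  | fn f i args C ih => simp only [comp, plug, ih]

theorem Step.plug (C : Context S V) {a b : Exp S V} (h : Step P a b) :
    Step P (C.plug a) (C.plug b) := by
  obtain ⟨D, R, hR, σ⟩ := h
  simpa only [Context.plug_comp] using Step.mk (C.comp D) R hR σ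

theorem Rewrites.plug (C : Context S V) {a b : Exp S V} (h : Rewrites P a b) :
    Rewrites P (C.plug a) (C.plug b) :=
  Relation.ReflTransGen.lift C.plug (fun _ _ => Step.plug C) _ _ h

instance : IsPreorder (Exp S V) (Rewrites P) :=
  inferInstanceAs (IsPreorder (Exp S V) (Relation.ReflTransGen (Step P)))

theorem Rewrites.con {n : ℕ} (c : S.Con n) {a b : Fin n → Exp S V}
    (h : ∀ i, Rewrites P (a i) (b i)) : Rewrites P (.con c a) (.con c b) :=
  rel_of_forall_rel_of_update (fun args i _ _ => Rewrites.plug (.con c i args .hole)) h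

theorem Rewrites.fn {n : ℕ} (f : S.Fn n) {a b : Fin n → Exp S V}
    (h : ∀ i, Rewrites P (a i) (b i)) : Rewrites P (.fn f a) (.fn f b) :=
  rel_of_forall_rel_of_update (fun args i _ _ => Rewrites.plug (.fn f i args .hole)) h

end Congruence

section Variables

namespace Exp

@[simp]
theorem mem_vars_var {x y : V} : x ∈ (var y : Exp S V).vars ↔ x = y := by simp [vars]

@[simp]
theorem mem_vars_con {n : ℕ} {c : S.Con n} {args : Fin n → Exp S V} {x : V} :
    x ∈ (con c args).vars ↔ ∃ i, x ∈ (args i).vars := by simp [vars]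

@[simp]
theorem mem_vars_fn {n : ℕ} {f : S.Fn n} {args : Fin n → Exp S V} {x : V} :
    x ∈ (fn f args).vars ↔ ∃ i, x ∈ (args i).vars := by simp [vars]

theorem not_isGround_var (x : V) : ¬ (var x : Exp S V).IsGround := by simp [IsGround, vars]

theorem IsGround.of_con {n : ℕ} {c : S.Con n} {args : Fin n → Exp S V}
    (h : (con c args).IsGround) (i : Fin n) : (args i).IsGround :=
  Finset.eq_empty_of_forall_notMem fun x hx =>
    Finset.eq_empty_iff_forall_notMem.1 h x (mem_vars_con.2 ⟨i, hx⟩)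

theorem vars_lift (e : Exp S V) : e.lift.vars = e.vars := by
  induction e with
  | var x => rfl
  | con c args ih => simp only [lift, vars, ih]
  | fn f args ih => simp only [lift, vars, ih]

theorem occ_pos {x : V} {e : Exp S V} : 0 < e.occ x ↔ x ∈ e.vars := by
  induction e with
  | var y => simp [occ, Nat.pos_iff_ne_zero, eq_comm]
  | con c args ih => simp [occ, Finset.sum_pos_iff, ih]
  | fn f args ih => simp [occ, Finset.sum_pos_iff, ih]

end Exp

/-- A tuple of expressions is linear if every variable occurs at most once in the whole tuple. -/
def IsLinear {n : ℕ} (ps : Fin n → Exp S V) : Prop :=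
  ∀ x, ∑ i, (ps i).occ x ≤ 1

theorem IsLinear.occ_le_one {n : ℕ} {ps : Fin n → Exp S V} (h : IsLinear ps) (i : Fin n) (x : V) :
    (ps i).occ x ≤ 1 :=
  (Finset.single_le_sum (f := fun k => (ps k).occ x) (fun _ _ => Nat.zero_le _)
    (Finset.mem_univ i)).trans (h x)

theorem IsLinear.pairwise_disjoint_vars {n : ℕ} {ps : Fin n → Exp S V} (h : IsLinear ps) :
    Pairwise fun i j => Disjoint (ps i).vars (ps j).vars := by
  intro i j hij
  refine Finset.disjoint_left.2 fun x hi hj => ?_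
  have hsum := Finset.add_le_sum (f := fun k => (ps k).occ x) (fun _ _ => Nat.zero_le _)
    (Finset.mem_univ i) (Finset.mem_univ j) hij
  have := Exp.occ_pos.2 hi
  have := Exp.occ_pos.2 hj
  have := h x
  lia

theorem exists_forall_eq_of_pairwise_disjoint {ι α β : Type*} {s : ι → Finset α}
    (hs : Pairwise fun i j => Disjoint (s i) (s j)) {p : α → β → Prop} (hp : ∀ x, ∃ y, p x y)
    {η : ι → α → β} (hη : ∀ i x, p x (η i x)) :
    ∃ θ : α → β, (∀ x, p x (θ x)) ∧ ∀ i, ∀ x ∈ s i, θ x = η i x := by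
  have hpoint (x : α) : ∃ y, p x y ∧ ∀ i, x ∈ s i → y = η i x := by
    by_cases hx : ∃ i, x ∈ s i
    · obtain ⟨i, hi⟩ := hx
      refine ⟨η i x, hη i x, fun j hj => ?_⟩
      rw [hs.eq fun hd => Finset.disjoint_left.1 hd hi hj]
    · obtain ⟨y, hy⟩ := hp x
      exact ⟨y, hy, fun i hi => (hx ⟨i, hi⟩).elim⟩
  choose θ hθ hθη using hpoint
  exact ⟨θ, hθ, fun i x => hθη x i⟩

end Variables

section Substitution

/-- The instance `eθ` for a map `θ` that may move infinitely many variables, unlike a `Subst`. Such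
maps can be composed and glued without keeping track of their domains. -/
def Exp.bind (θ : V → Exp S V) : Exp S V → Exp S V
  | .var x => θ x
  | .con c args => .con c fun i => (args i).bind θ
  | .fn f args => .fn f fun i => (args i).bind θ

namespace Exp

theorem subst_eq_bind (σ : Subst S V) (e : Exp S V) : e.subst σ = e.bind σ.toFun := by
  induction e with
  | var x => rfl
  | con c args ih => simp only [subst, bind, ih]
  | fn f args ih => simp only [subst, bind, ih]

theorem bind_congr {θ η : V → Exp S V} {e : Exp S V} (h : ∀ x ∈ e.vars, θ x = η x) :
    e.bind θ = e.bind η := by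
  induction e with
  | var x => exact h x (mem_vars_var.2 rfl)
  | con c args ih =>
    exact congrArg (con c) (funext fun i => ih i fun x hx => h x (mem_vars_con.2 ⟨i, hx⟩))
  | fn f args ih =>
    exact congrArg (fn f) (funext fun i => ih i fun x hx => h x (mem_vars_fn.2 ⟨i, hx⟩))

theorem bind_bind (θ η : V → Exp S V) (e : Exp S V) :
    (e.bind θ).bind η = e.bind fun x => (θ x).bind η := by
  induction e with
  | var x => rfl
  | con c args ih => simp only [bind, ih]
  | fn f args ih => simp only [bind, ih]

theorem gen_bind (θ : V → Exp S.withGen V) : gen.bind θ = gen :=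
  congrArg (fn (S := S.withGen) GenFn.gen) (Subsingleton.elim _ _)

end Exp

open scoped Classical in
/-- The substitution that agrees with `θ` on `X` and fixes all other variables. -/
noncomputable def Subst.restrict (X : Finset V) (θ : V → Exp S V) : Subst S V where
  toFun := X.piecewise θ Exp.var
  finite_dom := X.finite_toSet.subset fun _ hx => by
    by_contra h
    exact hx (X.piecewise_eq_of_notMem _ _ h)

theorem Subst.restrict_of_mem {X : Finset V} (θ : V → Exp S V) {x : V} (hx : x ∈ X) :
    (restrict X θ).toFun x = θ x :=
  if_pos hx

theorem Subst.dom_restrict {X : Finset V} {θ : V → Exp S V} (h : ∀ x ∈ X, θ x ≠ .var x) :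
    (restrict X θ).dom = X := by
  ext x
  by_cases hx : x ∈ X <;> simp [dom, restrict, hx, h]

theorem genSubst_eq_restrict (X : Finset V) :
    genSubst (S := S) X = Subst.restrict X fun _ => Exp.gen := rfl

theorem Rewrites.rule {R : Rule S V} (hR : R ∈ P) (θ : V → Exp S V) :
    Rewrites P (R.lhs.bind θ) (R.rhs.bind θ) := by
  classical
  let σ := Subst.restrict (R.lhs.vars ∪ R.rhs.vars) θ
  have hl : R.lhs.bind σ.toFun = R.lhs.bind θ :=
    Exp.bind_congr fun x hx => Subst.restrict_of_mem θ (Finset.mem_union_left _ hx)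
  have hr : R.rhs.bind σ.toFun = R.rhs.bind θ :=
    Exp.bind_congr fun x hx => Subst.restrict_of_mem θ (Finset.mem_union_right _ hx)
  rw [← hl, ← hr, ← Exp.subst_eq_bind, ← Exp.subst_eq_bind]
  exact .single (.mk .hole R hR σ)

/-- The behaviour of the rules for `?`: a choice `a ? b` rewrites to both `a` and `b`. -/
def HasChoice (P : Set (Rule S V)) : Prop :=
  ∀ a b, Rewrites P (.fn S.choice ![a, b]) a ∧ Rewrites P (.fn S.choice ![a, b]) b

theorem IsProgram.hasChoice (hP : IsProgram P) : HasChoice P := by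
  obtain ⟨-, x, y, hxy, hrules⟩ := hP
  intro a b
  classical
  let θ : V → Exp S V := Function.update (fun _ => b) x a
  have hx : θ x = a := Function.update_self ..
  have hy : θ y = b := Function.update_of_ne hxy.symm ..
  have hlhs : (Exp.fn S.choice ![.var x, .var y]).bind θ = .fn S.choice ![a, b] := by
    refine congrArg (Exp.fn S.choice) (funext fun i => ?_)
    fin_cases i
    exacts [hx, hy]
  have hleft := Rewrites.rule ((hrules _ _).2 ⟨rfl, .inl rfl⟩) θ
  have hright := Rewrites.rule ((hrules _ _).2 ⟨rfl, .inr rfl⟩) θ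
  simp only [Rule.lhs, hlhs, Exp.bind, hx, hy] at hleft hright
  exact ⟨hleft, hright⟩

open scoped Classical in
theorem Rule.gt_rhs_bind (R : Rule S V) (θ : V → Exp S.withGen V) :
    R.gt.rhs.bind θ = R.rhs.lift.bind (R.extraVars.piecewise (fun _ => Exp.gen) θ) := by
  simp only [gt, Exp.subst_eq_bind, Exp.bind_bind]
  congr 1 with x
  by_cases hx : x ∈ R.extraVars <;> simp [genSubst, hx, Exp.gen_bind, Exp.bind]

theorem Rewrites.gen {n : ℕ} (c : S.Con n) :
    Rewrites (gt P) Exp.gen (.con (S := S.withGen) c fun _ => Exp.gen) := by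
  have h := Rewrites.rule (P := gt P) (R := genRule V c) (.inl ⟨n, c, rfl⟩) Exp.var
  have hlhs : (genRule V c).lhs.bind Exp.var = Exp.gen := Exp.gen_bind _
  have hrhs : (genRule V c).rhs.bind Exp.var = .con (S := S.withGen) c fun _ => Exp.gen := by
    simp only [genRule, Exp.bind, Exp.gen_bind]
  rwa [hlhs, hrhs] at h

theorem Rewrites.gt_rule {R : Rule S V} (hR : R ∈ P) (θ : V → Exp S.withGen V) :
    Rewrites (gt P) (R.lhs.lift.bind θ) (R.gt.rhs.bind θ) :=
  Rewrites.rule (R := R.gt) (.inr ⟨R, hR, rfl⟩) θ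

end Substitution

section Soundness

/-- Replacement of every occurrence of `gen` by `g`, which reads an expression over `Σ ∪ {gen}` as
one over `Σ`. -/
def fillGen (g : Exp S V) : Exp S.withGen V → Exp S V
  | .var x => .var x
  | .con c args => .con (S := S) c fun i => fillGen g (args i)
  | .fn GenFn.gen _ => g
  | .fn (GenFn.old f) args => .fn f fun i => fillGen g (args i)

theorem fillGen_lift_bind (g : Exp S V) (θ : V → Exp S.withGen V) (e : Exp S V) :
    fillGen g (e.lift.bind θ) = e.bind fun x => fillGen g (θ x) := by
  induction e with
  | var x => rfl
  | con c args ih => simp only [Exp.lift, Exp.bind, fillGen, ih]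
  | fn f args ih => simp only [Exp.lift, Exp.bind, fillGen, ih]

theorem fillGen_lift_subst_genSubst (g : Exp S V) (X : Finset V) (e : Exp S V) :
    fillGen g (e.lift.subst (genSubst X)) = e.subst (.restrict X fun _ => g) := by
  simp only [Exp.subst_eq_bind, fillGen_lift_bind, genSubst_eq_restrict]
  congr 1 with x
  by_cases hx : x ∈ X <;> simp [Subst.restrict, hx, fillGen, Exp.gen]

theorem rewrites_fillGen_fn {g g' : Exp S V} (hg : Rewrites P g g') {n : ℕ} (f : S.withGen.Fn n)
    {a b : Fin n → Exp S.withGen V} (h : ∀ i, Rewrites P (fillGen g (a i)) (fillGen g' (b i))) :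
    Rewrites P (fillGen g (.fn f a)) (fillGen g' (.fn f b)) := by
  cases f with
  | gen => exact hg
  | old f => simpa only [fillGen] using Rewrites.fn f h

theorem rewrites_fillGen {g g' : Exp S V} (hg : Rewrites P g g') (e : Exp S.withGen V) :
    Rewrites P (fillGen g e) (fillGen g' e) := by
  induction e with
  | var x => exact .refl
  | con c _ ih => exact Rewrites.con (S := S) c ih
  | fn f _ ih => exact rewrites_fillGen_fn hg f ih

theorem rewrites_fillGen_plug {g g' : Exp S V} (hg : Rewrites P g g') (C : Context S.withGen V)
    {a b : Exp S.withGen V} (hab : Rewrites P (fillGen g a) (fillGen g' b)) :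
    Rewrites P (fillGen g (C.plug a)) (fillGen g' (C.plug b)) :=
  C.rel_plug (r := fun a b => Rewrites P (fillGen g a) (fillGen g' b)) (rewrites_fillGen hg)
    (fun c => Rewrites.con (S := S) c) (rewrites_fillGen_fn hg) hab

theorem rewrites_fillGen_gt_rule {R : Rule S V} (hR : R ∈ P) (g : Exp S V)
    (θ : V → Exp S.withGen V) :
    Rewrites P (fillGen g (R.lhs.lift.bind θ)) (fillGen g (R.gt.rhs.bind θ)) := by
  classical
  rw [Rule.gt_rhs_bind, fillGen_lift_bind, fillGen_lift_bind]
  convert Rewrites.rule hR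
    fun x => fillGen g (R.extraVars.piecewise (fun _ => Exp.gen) θ x) using 1
  refine Exp.bind_congr fun x hx => ?_
  have hx' : x ∉ R.extraVars := fun h => (Finset.mem_sdiff.1 h).2 hx
  rw [Finset.piecewise_eq_of_notMem _ _ _ hx']

theorem Step.exists_rewrites_fillGen (hP : HasChoice P) {a b : Exp S.withGen V}
    (h : Step (gt P) a b) (g : Exp S V) : ∃ g', Rewrites P (fillGen g' a) (fillGen g b) := by
  obtain ⟨C, _, ⟨n, c, rfl⟩ | ⟨R, hR, rfl⟩, σ⟩ := h
  · obtain ⟨hleft, hright⟩ := hP (.con c fun _ => g) g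
    exact ⟨_, rewrites_fillGen_plug hright C hleft⟩
  · refine ⟨g, rewrites_fillGen_plug .refl C ?_⟩
    rw [Exp.subst_eq_bind, Exp.subst_eq_bind]
    exact rewrites_fillGen_gt_rule hR g σ.toFun

theorem Rewrites.exists_rewrites_fillGen (hP : HasChoice P) {a b : Exp S.withGen V}
    (h : Rewrites (gt P) a b) (g : Exp S V) : ∃ g', Rewrites P (fillGen g' a) (fillGen g b) := by
  induction h using Relation.ReflTransGen.head_induction_on with
  | refl => exact ⟨g, .refl⟩
  | head hstep _ ih =>
    obtain ⟨g₁, hg₁⟩ := ih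
    obtain ⟨g₂, hg₂⟩ := hstep.exists_rewrites_fillGen hP g₁
    exact ⟨g₂, hg₂.trans hg₁⟩

theorem shell_approx_shell_fillGen (g : Exp S V) (e : Exp S.withGen V) :
    Approx e.shell (fillGen g e).lift.shell := by
  induction e with
  | var x => exact .refl _
  | con _ _ ih => exact Approx.con _ ih
  | fn _ _ _ => exact .bot_le _

theorem Exp.IsCTerm.lift_fillGen (g : Exp S V) {e : Exp S.withGen V} (h : e.IsCTerm) :
    (fillGen g e).lift = e := by
  induction e with
  | var x => rfl
  | con c _ ih => exact congrArg (con (S := S.withGen) c) (funext fun i => ih i (h i))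
  | fn _ _ _ => exact h.elim

end Soundness

section Completeness

/-- `GenLE b a` says that `b` arises from `a` by replacing some subexpressions by `gen`. It is the
invariant that relates the derivations in `gt P` to those in `P`. -/
inductive GenLE : Exp S.withGen V → Exp S V → Prop
  | gen (a : Exp S V) : GenLE Exp.gen a
  | var (x : V) : GenLE (.var x) (.var x)
  | con {n : ℕ} (c : S.Con n) {bs : Fin n → Exp S.withGen V} {as : Fin n → Exp S V}
      (h : ∀ i, GenLE (bs i) (as i)) : GenLE (.con (S := S.withGen) c bs) (.con c as)
  | fn {n : ℕ} (f : S.Fn n) {bs : Fin n → Exp S.withGen V} {as : Fin n → Exp S V}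
      (h : ∀ i, GenLE (bs i) (as i)) : GenLE (.fn (S := S.withGen) (GenFn.old f) bs) (.fn f as)

theorem GenLE.lift_bind {θ' : V → Exp S.withGen V} {θ : V → Exp S V}
    (h : ∀ x, GenLE (θ' x) (θ x)) (e : Exp S V) : GenLE (e.lift.bind θ') (e.bind θ) := by
  induction e with
  | var x => exact h x
  | con c _ ih => exact .con c ih
  | fn f _ ih => exact .fn f ih

theorem genLE_lift_subst_genSubst_dom (σ : Subst S V) (e : Exp S V) :
    GenLE (e.lift.subst (genSubst σ.dom)) (e.subst σ) := by
  rw [Exp.subst_eq_bind, Exp.subst_eq_bind]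
  refine .lift_bind (fun x => ?_) e
  by_cases hx : σ.toFun x = .var x
  · simpa [genSubst, Subst.dom, hx] using GenLE.var x
  · simpa [genSubst, Subst.dom, hx] using GenLE.gen _

theorem GenLE.exists_rewrites_con {n : ℕ} {c : S.Con n} {as : Fin n → Exp S V}
    {b : Exp S.withGen V} (h : GenLE b (.con c as)) :
    ∃ bs : Fin n → Exp S.withGen V, (∀ i, GenLE (bs i) (as i)) ∧
      Rewrites (gt P) b (.con (S := S.withGen) c bs) := by
  cases h with
  | gen => exact ⟨_, fun i => .gen (as i), .gen c⟩
  | con _ h => exact ⟨_, h, .refl⟩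

theorem IsLinear.exists_rewrites_lift_bind {n : ℕ} {ps : Fin n → Exp S V} (hlin : IsLinear ps)
    {θ : V → Exp S V} {bs : Fin n → Exp S.withGen V}
    (h : ∀ i, ∃ θ' : V → Exp S.withGen V, (∀ x, GenLE (θ' x) (θ x)) ∧
      Rewrites (gt P) (bs i) ((ps i).lift.bind θ')) :
    ∃ θ' : V → Exp S.withGen V, (∀ x, GenLE (θ' x) (θ x)) ∧
      ∀ i, Rewrites (gt P) (bs i) ((ps i).lift.bind θ') := by
  choose η hη hr using h
  obtain ⟨θ', hθ', heq⟩ := exists_forall_eq_of_pairwise_disjoint hlin.pairwise_disjoint_vars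
    (p := fun x b => GenLE b (θ x)) (fun x => ⟨_, .gen (θ x)⟩) hη
  refine ⟨θ', hθ', fun i => ?_⟩
  rw [Exp.bind_congr fun x hx => heq i x (Exp.vars_lift (ps i) ▸ hx)]
  exact hr i

theorem GenLE.exists_rewrites_lift_bind {p : Exp S V} (hp : p.IsCTerm) (hlin : ∀ x, p.occ x ≤ 1)
    {θ : V → Exp S V} {b : Exp S.withGen V} (h : GenLE b (p.bind θ)) :
    ∃ θ' : V → Exp S.withGen V, (∀ x, GenLE (θ' x) (θ x)) ∧
      Rewrites (gt P) b (p.lift.bind θ') := by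
  induction p generalizing b with
  | var x =>
    classical
    refine ⟨Function.update (fun _ => .gen) x b, fun y => ?_, ?_⟩
    · obtain rfl | hy := eq_or_ne y x
      · simpa [Exp.bind] using h
      · simpa [hy] using GenLE.gen (θ y)
    · simpa only [Exp.lift, Exp.bind, Function.update_self] using refl_of (Rewrites (gt P)) b
  | con c ps ih =>
    obtain ⟨bs, hbs, hr⟩ := exists_rewrites_con (P := P) h
    have hps : IsLinear ps := hlin
    obtain ⟨θ', hθ', hr'⟩ := hps.exists_rewrites_lift_bind fun i =>
      ih i (hp i) (hps.occ_le_one i) (hbs i)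
    exact ⟨θ', hθ', hr.trans (Rewrites.con (S := S.withGen) c hr')⟩
  | fn _ _ _ => exact hp.elim

/-- The simulation relation of the completeness proof: whatever lies `GenLE`-below `a` can be
rewritten in `gt P` until it lies below `a'`. This relation contains rewriting in `P`. -/
def GenSimulates (P : Set (Rule S V)) (a a' : Exp S V) : Prop :=
  ∀ ⦃b⦄, GenLE b a → ∃ b', Rewrites (gt P) b b' ∧ GenLE b' a'

namespace GenSimulates

theorem refl (a : Exp S V) : GenSimulates P a a := fun b hb => ⟨b, .refl, hb⟩

theorem trans {a₁ a₂ a₃ : Exp S V} (h₁ : GenSimulates P a₁ a₂) (h₂ : GenSimulates P a₂ a₃) :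
    GenSimulates P a₁ a₃ := by
  intro b₁ hb₁
  obtain ⟨b₂, hr₁, hb₂⟩ := h₁ hb₁
  obtain ⟨b₃, hr₂, hb₃⟩ := h₂ hb₂
  exact ⟨b₃, hr₁.trans hr₂, hb₃⟩

theorem con {n : ℕ} (c : S.Con n) {as as' : Fin n → Exp S V}
    (h : ∀ i, GenSimulates P (as i) (as' i)) : GenSimulates P (.con c as) (.con c as') := by
  rintro _ (_ | _ | ⟨_, hbs⟩)
  · exact ⟨_, .refl, .gen _⟩
  · choose bs' hr hbs' using fun i => h i (hbs i)
    exact ⟨_, Rewrites.con (S := S.withGen) c hr, .con c hbs'⟩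

theorem fn {n : ℕ} (f : S.Fn n) {as as' : Fin n → Exp S V}
    (h : ∀ i, GenSimulates P (as i) (as' i)) : GenSimulates P (.fn f as) (.fn f as') := by
  rintro _ (_ | _ | _ | ⟨_, hbs⟩)
  · exact ⟨_, .refl, .gen _⟩
  · choose bs' hr hbs' using fun i => h i (hbs i)
    exact ⟨_, Rewrites.fn (S := S.withGen) (GenFn.old f) hr, .fn f hbs'⟩

theorem rule {R : Rule S V} (hR : R ∈ P) (hc : R.IsCRule) (θ : V → Exp S V) :
    GenSimulates P (R.lhs.bind θ) (R.rhs.bind θ) := by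
  obtain ⟨hpats, hlin⟩ := hc
  have hlin : IsLinear R.pats := hlin
  rintro _ (_ | _ | _ | ⟨_, hbs⟩)
  · exact ⟨_, .refl, .gen _⟩
  · obtain ⟨θ', hθ', hr⟩ := hlin.exists_rewrites_lift_bind fun i =>
      (hbs i).exists_rewrites_lift_bind (P := P) (hpats i) (hlin.occ_le_one i)
    have hlhs := Rewrites.fn (S := S.withGen) (GenFn.old R.head) hr
    refine ⟨_, hlhs.trans (Rewrites.gt_rule hR θ'), ?_⟩
    classical
    rw [Rule.gt_rhs_bind]
    refine .lift_bind (fun x => ?_) R.rhs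
    exact R.extraVars.piecewise_cases _ θ' (GenLE · (θ x)) (.gen _) (hθ' x)

theorem of_rewrites (hP : ∀ R ∈ P, R.IsCRule) {a a' : Exp S V} (h : Rewrites P a a') :
    GenSimulates P a a' := by
  induction h with
  | refl => exact refl a
  | tail _ hstep ih =>
    obtain ⟨C, R, hR, σ⟩ := hstep
    have hrule := rule hR (hP R hR) σ.toFun
    rw [← Exp.subst_eq_bind, ← Exp.subst_eq_bind] at hrule
    exact ih.trans (C.rel_plug refl con fn hrule)

end GenSimulates

theorem GenLE.exists_shell_approx {a : Exp S V} (ha : a.IsGround) {b : Exp S.withGen V}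
    (h : GenLE b a) : ∃ b', Rewrites (gt P) b b' ∧ Approx a.lift.shell b'.shell := by
  induction a generalizing b with
  | var x => exact (Exp.not_isGround_var x ha).elim
  | con c as ih =>
    obtain ⟨bs, hbs, hr⟩ := exists_rewrites_con (P := P) h
    choose bs' hr' hshell using fun i => ih i (ha.of_con i) (hbs i)
    exact ⟨_, hr.trans (Rewrites.con (S := S.withGen) c hr'), Approx.con _ hshell⟩
  | fn _ _ _ => exact ⟨b, .refl, .bot_le _⟩

theorem GenLE.rewrites_lift {t : Exp S V} (ht : t.IsGround) (hc : t.IsCTerm)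
    {b : Exp S.withGen V} (h : GenLE b t) : Rewrites (gt P) b t.lift := by
  induction t generalizing b with
  | var x => exact (Exp.not_isGround_var x ht).elim
  | con c ts ih =>
    obtain ⟨bs, hbs, hr⟩ := exists_rewrites_con (P := P) h
    exact hr.trans (Rewrites.con (S := S.withGen) c fun i => ih i (ht.of_con i) (hc i) (hbs i))
  | fn _ _ _ => exact hc.elim

end Completeness

end GenLift

open GenLift in
theorem mainTheorem1_general {S : Signature.{u, v}} {V : Type w} (P : Set (Rule S V)) :
    (HasChoice P → ∀ (e : Exp S V) (X : Finset V) (e' : Exp S.withGen V),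
      Rewrites (gt P) (e.lift.subst (genSubst X)) e' →
      ∃ σ : Subst S V, σ.dom = X ∧
        (∃ e'' : Exp S V, Rewrites P (e.subst σ) e'' ∧ Approx e'.shell e''.lift.shell) ∧
        (e'.IsCTerm → ∃ t : Exp S V, t.lift = e' ∧ Rewrites P (e.subst σ) t)) ∧
    ((∀ R ∈ P, R.IsCRule) → ∀ (e e' : Exp S V) (σ : Subst S V), e'.IsGround →
      Rewrites P (e.subst σ) e' →
      (∃ e'' : Exp S.withGen V, Rewrites (gt P) (e.lift.subst (genSubst σ.dom)) e'' ∧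
        Approx e'.lift.shell e''.shell) ∧
      (e'.IsCTerm → Rewrites (gt P) (e.lift.subst (genSubst σ.dom)) e'.lift)) := by
  constructor
  · intro hP e X e' h
    obtain ⟨g, hg⟩ := h.exists_rewrites_fillGen hP e
    -- Passing to `g ? g` keeps the domain equal to `X` even if `g` is a variable.
    have hr := (rewrites_fillGen (hP g g).1 _).trans hg
    rw [fillGen_lift_subst_genSubst] at hr
    exact ⟨_, Subst.dom_restrict (by simp),
      ⟨_, hr, shell_approx_shell_fillGen e e'⟩, fun hc => ⟨_, hc.lift_fillGen e, hr⟩⟩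
  · intro hP e e' σ he' h
    obtain ⟨b, hr, hb⟩ := GenSimulates.of_rewrites hP h (genLE_lift_subst_genSubst_dom σ e)
    obtain ⟨b', hr', hshell⟩ := hb.exists_shell_approx he'
    exact ⟨⟨b', hr.trans hr', hshell⟩, fun hc => hr.trans (hb.rewrites_lift he' hc)⟩

theorem mainTheorem1 {S : GenLift.Signature.{u, v}} {V : Type w} [Countable V] [Infinite V]
    (P : Set (GenLift.Rule S V)) (hP : GenLift.IsProgram P) :
    -- Soundness
    (∀ (e : GenLift.Exp S V) (X : Finset V) (e' : GenLift.Exp S.withGen V), e'.IsGround →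
      GenLift.Rewrites (GenLift.gt P) (e.lift.subst (GenLift.genSubst X)) e' →
      ∃ σ : GenLift.Subst S V, σ.dom = X ∧
        (∃ e'' : GenLift.Exp S V, GenLift.Rewrites P (e.subst σ) e'' ∧
          GenLift.Approx e'.shell e''.lift.shell) ∧
        (e'.IsCTerm → ∃ t : GenLift.Exp S V, t.lift = e' ∧ GenLift.Rewrites P (e.subst σ) t)) ∧
    -- Completeness
    (∀ (e e' : GenLift.Exp S V) (σ : GenLift.Subst S V), e'.IsGround →
      GenLift.Rewrites P (e.subst σ) e' →
      (∃ e'' : GenLift.Exp S.withGen V,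
        GenLift.Rewrites (GenLift.gt P) (e.lift.subst (GenLift.genSubst σ.dom)) e'' ∧
          GenLift.Approx e'.lift.shell e''.shell) ∧
      (e'.IsCTerm →
        GenLift.Rewrites (GenLift.gt P) (e.lift.subst (GenLift.genSubst σ.dom)) e'.lift)) := by
  obtain ⟨sound, complete⟩ := mainTheorem1_general P
  exact ⟨fun e X e' _ => sound hP.hasChoice e X e', complete hP.1⟩
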